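/- Let $M$ be a smooth (Hausdorff, finite-dimensional, boundaryless) real manifold and let $K\in\Omega^1(M;TM)$ be a smooth vector-valued $1$-form, i.e. a smooth bundle endomorphism $K:TM\to TM$. Let $D=\mathcal L_K=[\imath_K,\mathrm d]=\imath_K\circ \mathrm d-\mathrm d\circ\imath_K$ be the Lie derivative along $K$, a derivation of degree $1$ of the differential forms $\Omega(M)$, where $\imath_K\omega(Z_1,\dots,Z_p)=\sum_{j}\omega(Z_1,\dots,KZ_j,\dots,Z_p)$. A Lie algebroid structure on $TM$ consists of a smooth bundle map $q:TM\to TM$ (the anchor) and an $\mathbb R$-bilinear Lie bracket $[\![\cdot,\cdot]\!]$ on the smooth vector fields with $[\![X,fY]\!]=f[\![X,Y]\!]+(qX)(f)\,Y$. It is said to be induced by $D$ if $$(qX)(f)=Df(X),\qquad \alpha([\![X,Y]\!])=D(\alpha(Y))(X)-D(\alpha(X))(Y)-D\alpha(X,Y)$$ for all smooth functions $f$, smooth $1$-forms $\alpha$ and smooth vector fields $X,Y$. Then $D=\mathcal L_K$ induces a Lie algebroid structure on $TM$ with anchor $q=K$ and bracket the contracted bracket $$[X,Y]_K=[KX,Y]+[X,KY]-K[X,Y]$$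 if and only if the Nijenhuis torsion of $K$, $$T_K(X,Y)=[KX,KY]-K[KX,Y]-K[X,KY]+K^2[X,Y],$$ vanishes identically. Moreover, any Lie algebroid structure on $TM$ induced by $\mathcal L_K$ has anchor $K$ and bracket $[\cdot,\cdot]_K$. -/

import Mathlib

open scoped Manifold ContDiff Bundle
open VectorField

noncomputable section

section Algebra

variable {V : Type*} [AddCommGroup V] [Module ℝ V] [TopologicalSpace V] {p : ℕ}

/-- The insertion `i_k η` of an endomorphism `k` of `V` in an alternating `p`-form `η` on `V`:
`(i_k η)(v₁, …, v_p) = ∑ j, η(v₁, …, k v_j, …, v_p)`. On `0`-forms it vanishes. -/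
def insertEndomorphism (k : V →L[ℝ] V) (η : V [⋀^Fin p]→L[ℝ] ℝ) : V [⋀^Fin p]→L[ℝ] ℝ where
  toContinuousMultilinearMap := ∑ j : Fin p,
    η.toContinuousMultilinearMap.compContinuousLinearMap
      (Function.update (fun _ => ContinuousLinearMap.id ℝ V) j k)
  map_eq_zero_of_eq' := by
    intro v a b hv hab
    have key : ∀ j : Fin p,
        (fun i => (Function.update (fun _ => ContinuousLinearMap.id ℝ V) j k) i (v i)) =
          Function.update v j (k (v j)) := by
      intro j
      funext i
      by_cases h : i = j
      · subst h; simp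
      · simp [h]
    have hsum : ∀ j : Fin p, j ≠ a ∧ j ≠ b → η (Function.update v j (k (v j))) = 0 := by
      rintro j ⟨ha, hb⟩
      refine η.map_eq_zero_of_eq _ (i := a) (j := b) ?_ hab
      simp [ha.symm, hb.symm, hv]
    have hswap : η (Function.update v b (k (v b))) = - η (Function.update v a (k (v a))) := by
      rw [show η (Function.update v a (k (v a))) = η.toAlternatingMap (Function.update v a (k (v a)))
        from rfl, ← η.toAlternatingMap.map_swap _ hab]
      change η _ = η _
      congr 1
      funext i
      by_cases hia : i = a
      · subst hia; simp [hab, Ne.symm hab, hv]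
      · by_cases hib : i = b
        · subst hib; simp [hv]
        · simp [Equiv.swap_apply_of_ne_of_ne hia hib, hia, hib]
    change (∑ j : Fin p, η.toContinuousMultilinearMap.compContinuousLinearMap
      (Function.update (fun _ => ContinuousLinearMap.id ℝ V) j k)) v = 0
    rw [_root_.sum_apply]
    have h2 : ∀ j : Fin p, (η.toContinuousMultilinearMap.compContinuousLinearMap
        (Function.update (fun _ => ContinuousLinearMap.id ℝ V) j k)) v =
          η (Function.update v j (k (v j))) := by
      intro j
      rw [← key j]
      rfl
    rw [Finset.sum_congr rfl (fun j _ => h2 j),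
      Finset.sum_eq_add a b hab (fun j _ hj => hsum j hj) (by simp) (by simp), hswap]
    simp

theorem insertEndomorphism_apply (k : V →L[ℝ] V) (η : V [⋀^Fin p]→L[ℝ] ℝ) (v : Fin p → V) :
    insertEndomorphism k η v = ∑ j : Fin p, η (Function.update v j (k (v j))) := by
  change (∑ j : Fin p, η.toContinuousMultilinearMap.compContinuousLinearMap
      (Function.update (fun _ => ContinuousLinearMap.id ℝ V) j k)) v = _
  rw [_root_.sum_apply]
  refine Finset.sum_congr rfl fun j _ => ?_
  change η _ = η _
  congr 1
  funext i
  by_cases h : i = j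
  · subst h; simp
  · simp [h]

end Algebra

section Manifold

variable {E : Type*} [NormedAddCommGroup E] [NormedSpace ℝ E]
  {H : Type*} [TopologicalSpace H] (I : ModelWithCorners ℝ E H)
  (M : Type*) [TopologicalSpace M] [ChartedSpace H M]

/-- A (not necessarily smooth) differential `p`-form on `M`. -/
abbrev DiffForm (p : ℕ) : Type _ := (x : M) → (TangentSpace I x) [⋀^Fin p]→L[ℝ] ℝ

variable {I M}

/-- The expression of a `p`-form in the preferred chart around `x₀`, that is its pullback by the
inverse of that chart, a `p`-form on (a subset of) the model space `E`. -/
def DiffForm.inChart {p : ℕ} (η : DiffForm I M p) (x₀ : M) : E → E [⋀^Fin p]→L[ℝ] ℝ :=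
  fun y => (η ((extChartAt I x₀).symm y)).compContinuousLinearMap
    (mfderivWithin 𝓘(ℝ, E) I (extChartAt I x₀).symm (Set.range I) y)

/-- A `p`-form is smooth if its expressions in the charts are smooth. -/
def DiffForm.IsSmooth {p : ℕ} (η : DiffForm I M p) : Prop :=
  ∀ x₀ : M, ContDiffOn ℝ ∞ (η.inChart x₀) (extChartAt I x₀).target

/-- The exterior derivative `d`: computed in the preferred chart at each point, and pulled back
to the manifold. -/
def DiffForm.extDeriv {p : ℕ} (η : DiffForm I M p) : DiffForm I M (p + 1) :=
  fun x => (extDerivWithin (η.inChart x) (Set.range I) (extChartAt I x x)).compContinuousLinearMap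
    (mfderiv I 𝓘(ℝ, E) (extChartAt I x) x)

/-- A function on `M`, seen as a `0`-form. -/
def DiffForm.ofFun (f : M → ℝ) : DiffForm I M 0 :=
  fun x => ContinuousAlternatingMap.constOfIsEmpty ℝ (TangentSpace I x) (Fin 0) (f x)

/-- The insertion `i_K` of a vector-valued `1`-form `K` (an endomorphism of `TM`) in `p`-forms. -/
def DiffForm.insertion (K : (x : M) → TangentSpace I x →L[ℝ] TangentSpace I x) {p : ℕ}
    (η : DiffForm I M p) : DiffForm I M p :=
  fun x => insertEndomorphism (K x) (η x)

/-- The Lie derivative `𝓛_K = [i_K, d] = i_K ∘ d - d ∘ i_K` along a vector-valued `1`-form `K`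
(so that `i_K` has degree `0`); it is an operator of degree `1` on differential forms. -/
def DiffForm.lieDeriv (K : (x : M) → TangentSpace I x →L[ℝ] TangentSpace I x) (p : ℕ)
    (η : DiffForm I M p) : DiffForm I M (p + 1) :=
  DiffForm.insertion K η.extDeriv - (DiffForm.insertion K η).extDeriv

variable (I) in
/-- The contracted bracket `[X, Y]_K = [KX, Y] + [X, KY] - K[X, Y]`. -/
def contractedBracket (K : (x : M) → TangentSpace I x →L[ℝ] TangentSpace I x)
    (X Y : (x : M) → TangentSpace I x) : (x : M) → TangentSpace I x :=
  fun x => mlieBracket I (fun y => K y (X y)) Y x + mlieBracket I X (fun y => K y (Y y)) x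
    - K x (mlieBracket I X Y x)

variable (I) in
/-- The Nijenhuis torsion `T_K(X, Y) = [KX, KY] - K[KX, Y] - K[X, KY] + K²[X, Y]`. -/
def nijenhuisTorsion (K : (x : M) → TangentSpace I x →L[ℝ] TangentSpace I x)
    (X Y : (x : M) → TangentSpace I x) : (x : M) → TangentSpace I x :=
  fun x => mlieBracket I (fun y => K y (X y)) (fun y => K y (Y y)) x
    - K x (mlieBracket I (fun y => K y (X y)) Y x) - K x (mlieBracket I X (fun y => K y (Y y)) x)
    + K x (K x (mlieBracket I X Y x))

variable (I) in
/-- The derivative `v(f)` of a function `f` on `M` along a tangent vector `v` at `x`. -/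
def dirDeriv (f : M → ℝ) (x : M) (v : TangentSpace I x) : ℝ :=
  mfderiv I 𝓘(ℝ, ℝ) f x v

section Algebroid

variable (F : Type*) [NormedAddCommGroup F] [NormedSpace ℝ F]
  (V : M → Type*) [TopologicalSpace (Bundle.TotalSpace F V)]
  [∀ x, AddCommGroup (V x)] [∀ x, Module ℝ (V x)] [∀ x, TopologicalSpace (V x)]
  [FiberBundle F V] [VectorBundle ℝ F V]

variable {F V} in
/-- The product `f A` of a smooth section `A` of a vector bundle by a smooth function `f`. -/
def smulSection (f : C^∞⟮I, M; 𝓘(ℝ, ℝ), ℝ⟯) (A : Cₛ^∞⟮I; F, V⟯) : Cₛ^∞⟮I; F, V⟯ :=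
  ⟨fun x => f x • A x, f.contMDiff.smul_section A.contMDiff⟩

variable (I) in
/-- A Lie algebroid structure on a vector bundle `V → M`: an anchor (a smooth bundle map
`V → TM`) and a Lie bracket on the smooth sections of `V` satisfying the Leibniz rule
`[A, f B] = f [A, B] + (anchor A)(f) B`. -/
structure LieAlgebroid [IsManifold I ∞ M] where
  /-- the anchor -/
  anchor : Cₛ^∞⟮I; F →L[ℝ] E, fun x : M => V x →L[ℝ] TangentSpace I x⟯
  /-- the bracket of sections, an `ℝ`-bilinear map -/
  bracket : Cₛ^∞⟮I; F, V⟯ →ₗ[ℝ] Cₛ^∞⟮I; F, V⟯ →ₗ[ℝ] Cₛ^∞⟮I; F, V⟯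
  bracket_self : ∀ A, bracket A A = 0
  jacobi : ∀ A B C,
    bracket A (bracket B C) + bracket B (bracket C A) + bracket C (bracket A B) = 0
  leibniz : ∀ (f : C^∞⟮I, M; 𝓘(ℝ, ℝ), ℝ⟯) (A B) (x : M),
    bracket A (smulSection f B) x =
      f x • bracket A B x + dirDeriv I f x (anchor x (A x)) • B x

end Algebroid

/-- A Lie algebroid structure on `TM`, with anchor `q` and bracket `⟦·,·⟧`, is induced by an
operator `D` of degree `1` on differential forms if
`q(X)(f) = Df(X)` and `α(⟦X, Y⟧) = D(α(Y))(X) - D(α(X))(Y) - Dα(X, Y)`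
for all smooth functions `f`, smooth `1`-forms `α` and smooth vector fields `X`, `Y`. -/
structure LieAlgebroid.IsInducedBy [IsManifold I ∞ M]
    (A : LieAlgebroid I E (fun x : M => TangentSpace I x))
    (D : (p : ℕ) → DiffForm I M p → DiffForm I M (p + 1)) : Prop where
  anchor_eq : ∀ (f : C^∞⟮I, M; 𝓘(ℝ, ℝ), ℝ⟯)
    (X : Cₛ^∞⟮I; E, fun x : M => TangentSpace I x⟯) (x : M),
    dirDeriv I f x (A.anchor x (X x)) = D 0 (DiffForm.ofFun f) x ![X x]
  bracket_eq : ∀ α : DiffForm I M 1, α.IsSmooth →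
    ∀ (X Y : Cₛ^∞⟮I; E, fun x : M => TangentSpace I x⟯) (x : M),
    α x ![A.bracket X Y x] =
      D 0 (DiffForm.ofFun fun y => α y ![Y y]) x ![X x]
      - D 0 (DiffForm.ofFun fun y => α y ![X y]) x ![Y x]
      - D 1 α x ![X x, Y x]

end Manifold

end

noncomputable section

open Set Filter Topology

section Extension

variable {E : Type*} [NormedAddCommGroup E] [NormedSpace ℝ E]
  {H : Type*} [TopologicalSpace H] {I : ModelWithCorners ℝ E H}
  {M : Type*} [TopologicalSpace M] [ChartedSpace H M]

/-- Every vector of a smooth vector bundle is the value of a global smooth section. -/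
theorem exists_contMDiffSection_apply_eq [FiniteDimensional ℝ E] [T2Space M] [IsManifold I ∞ M]
    {F : Type*} [NormedAddCommGroup F] [NormedSpace ℝ F]
    {V : M → Type*} [TopologicalSpace (Bundle.TotalSpace F V)]
    [∀ x, AddCommGroup (V x)] [∀ x, Module ℝ (V x)] [∀ x, TopologicalSpace (V x)]
    [FiberBundle F V] [VectorBundle ℝ F V] [ContMDiffVectorBundle ∞ F V I] {x : M} (v : V x) :
    ∃ X : Cₛ^∞⟮I; F, V⟯, X x = v := by
  obtain ⟨s, hs, hsv⟩ := FiberBundle.exists_contMDiffOn_extend I F (k := ∞) v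
  obtain ⟨f, -, hf⟩ := (SmoothBumpFunction.nhds_basis_tsupport (I := I) x).mem_iff.1
    (interior_mem_nhds.2 hs)
  refine ⟨⟨(f : M → ℝ) • FiberBundle.extend F v,
    ContMDiffOn.smul_section_of_tsupport f.contMDiff.contMDiffOn isOpen_interior hf
      (hsv.mono interior_subset)⟩, ?_⟩
  change f x • FiberBundle.extend F v x = v
  simp

/-- The differentials of global smooth functions detect nonzero tangent vectors. -/
theorem exists_dirDeriv_ne_zero [FiniteDimensional ℝ E] [T2Space M] [IsManifold I ∞ M] {x : M}
    {v : TangentSpace I x} (hv : v ≠ 0) :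
    ∃ f : C^∞⟮I, M; 𝓘(ℝ, ℝ), ℝ⟯, dirDeriv I f x v ≠ 0 := by
  have : IsManifold I 1 M := .of_le (n := ∞) (by simp)
  have hx : x ∈ (extChartAt I x).source := mem_extChartAt_source x
  obtain ⟨ℓ, hℓ⟩ : ∃ ℓ : E →L[ℝ] ℝ, ℓ (mfderiv I 𝓘(ℝ, E) (extChartAt I x) x v) ≠ 0 := by
    refine SeparatingDual.exists_ne_zero (R := ℝ) fun h => hv ?_
    exact (isInvertible_mfderiv_extChartAt hx).injective (h.trans (map_zero _).symm)
  obtain ⟨b⟩ : Nonempty (SmoothBumpFunction I x) := inferInstance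
  have hg : ContMDiffOn I 𝓘(ℝ, ℝ) ∞ (fun y => ℓ (extChartAt I x y)) (chartAt H x).source :=
    ℓ.contMDiff.comp_contMDiffOn contMDiffOn_extChartAt
  refine ⟨⟨fun y => b y • ℓ (extChartAt I x y), b.contMDiff_smul hg⟩, ?_⟩
  have heq : (fun y => b y • ℓ (extChartAt I x y)) =ᶠ[𝓝 x] ℓ ∘ extChartAt I x := by
    filter_upwards [b.eventuallyEq_one] with y hy
    simp [hy]
  change mfderiv I 𝓘(ℝ, ℝ) (fun y => b y • ℓ (extChartAt I x y)) x v ≠ 0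
  rw [heq.mfderiv_eq, mfderiv_comp x ℓ.differentiableAt.mdifferentiableAt
    (mdifferentiableAt_extChartAt (mem_chart_source H x)), ℓ.mfderiv_eq]
  exact hℓ

theorem eq_of_forall_dirDeriv_eq [FiniteDimensional ℝ E] [T2Space M] [IsManifold I ∞ M] {x : M}
    {v w : TangentSpace I x}
    (h : ∀ f : C^∞⟮I, M; 𝓘(ℝ, ℝ), ℝ⟯, dirDeriv I f x v = dirDeriv I f x w) : v = w := by
  by_contra hne
  obtain ⟨f, hf⟩ := exists_dirDeriv_ne_zero (I := I) (sub_ne_zero.2 hne)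
  exact hf ((map_sub (mfderiv I 𝓘(ℝ, ℝ) f x) v w).trans (sub_eq_zero.2 (h f)))

end Extension

section ChartCalculus

variable {E : Type*} [NormedAddCommGroup E] [NormedSpace ℝ E]
  {H : Type*} [TopologicalSpace H] {I : ModelWithCorners ℝ E H}
  {M : Type*} [TopologicalSpace M] [ChartedSpace H M]

variable (I) in
/-- The derivative at `x` of the preferred chart at `x`, with values in the model space. -/
def chartDeriv (x : M) : TangentSpace I x →L[ℝ] E :=
  mfderiv I 𝓘(ℝ, E) (extChartAt I x) x

variable (I) in
/-- The derivative of the inverse of the preferred chart at `x₀`. -/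
def chartSymmDeriv (x₀ : M) (y : E) : E →L[ℝ] TangentSpace I ((extChartAt I x₀).symm y) :=
  mfderivWithin 𝓘(ℝ, E) I (extChartAt I x₀).symm (range I) y

/-- A vector field read in the preferred chart at `x₀`. -/
def chartField (X : (x : M) → TangentSpace I x) (x₀ : M) : E → E :=
  mpullbackWithin 𝓘(ℝ, E) I (extChartAt I x₀).symm X (range I)

theorem dirDeriv_of_differentiableWithinAt [IsManifold I 1 M] {g : M → ℝ} {x : M}
    (hg : DifferentiableWithinAt ℝ (g ∘ (extChartAt I x).symm) (range I) (extChartAt I x x))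
    (v : TangentSpace I x) :
    dirDeriv I g x v = fderivWithin ℝ (g ∘ (extChartAt I x).symm) (range I) (extChartAt I x x)
      (chartDeriv I x v) := by
  have heq : g =ᶠ[𝓝 x] (g ∘ (extChartAt I x).symm) ∘ extChartAt I x := by
    filter_upwards [extChartAt_source_mem_nhds (I := I) x] with y hy
    exact (congrArg g ((extChartAt I x).left_inv hy)).symm
  have h1 : MDifferentiableWithinAt I 𝓘(ℝ, E) (extChartAt I x) univ x :=
    (mdifferentiableAt_extChartAt (mem_chart_source H x)).mdifferentiableWithinAt
  have := mfderivWithin_comp (I := I) (I' := 𝓘(ℝ, E)) (I'' := 𝓘(ℝ, ℝ)) (u := range I)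
    (s := univ) x hg.mdifferentiableWithinAt h1
    (fun y _ => by simp [extChartAt]) (uniqueMDiffWithinAt_univ I)
  rw [mfderivWithin_univ, mfderivWithin_univ] at this
  change mfderiv I 𝓘(ℝ, ℝ) g x v = _
  rw [heq.mfderiv_eq, this, mfderivWithin_eq_fderivWithin]
  rfl

theorem differentiableWithinAt_comp_extChartAt_symm {g : M → ℝ} {x : M}
    (hg : MDifferentiableAt I 𝓘(ℝ, ℝ) g x) :
    DifferentiableWithinAt ℝ (g ∘ (extChartAt I x).symm) (range I) (extChartAt I x x) :=
  ((mdifferentiableAt_iff _ _).1 hg).2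

theorem chartSymmDeriv_chartField [IsManifold I 1 M] (X : (x : M) → TangentSpace I x) {x₀ : M}
    {y : E} (hy : y ∈ (extChartAt I x₀).target) :
    chartSymmDeriv I x₀ y (chartField X x₀ y) = X ((extChartAt I x₀).symm y) :=
  (isInvertible_mfderivWithin_extChartAt_symm hy).self_apply_inverse _

/-- The value of a vector field at a point, read in the chart at this point. -/
theorem chartDeriv_apply [IsManifold I 1 M] (X : (x : M) → TangentSpace I x) (x : M) :
    chartDeriv I x (X x) = chartField X x (extChartAt I x x) := by
  have h := (eventuallyEq_mpullback_mpullbackWithin_extChartAt (s := univ) (x := x) X)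
  rw [nhdsWithin_univ] at h
  rw [h.self_of_nhds, mpullback_apply]
  exact (isInvertible_mfderiv_extChartAt (mem_extChartAt_source x)).self_apply_inverse _

theorem chartDeriv_mlieBracket [IsManifold I 1 M] (X Y : (x : M) → TangentSpace I x) (x : M) :
    chartDeriv I x (mlieBracket I X Y x) =
      lieBracketWithin ℝ (chartField X x) (chartField Y x) (range I) (extChartAt I x x) := by
  rw [← mlieBracketWithin_univ, mlieBracketWithin_apply, preimage_univ, univ_inter]
  exact (isInvertible_mfderiv_extChartAt (mem_extChartAt_source x)).self_apply_inverse _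

theorem differentiableWithinAt_chartField [CompleteSpace E] [IsManifold I 2 M]
    {X : (x : M) → TangentSpace I x} {x : M}
    (hX : MDifferentiableAt I I.tangent (fun y => (⟨y, X y⟩ : TangentBundle I M)) x) :
    DifferentiableWithinAt ℝ (chartField X x) (range I) (extChartAt I x x) := by
  have h := (mdifferentiableWithinAt_univ.2 hX).differentiableWithinAt_mpullbackWithin_vectorField
  rwa [preimage_univ, univ_inter] at h

namespace DiffForm

theorem inChart_apply {p : ℕ} (η : DiffForm I M p) (x₀ : M) (y : E) (v : Fin p → E) :
    η.inChart x₀ y v = η ((extChartAt I x₀).symm y) fun i => chartSymmDeriv I x₀ y (v i) :=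
  rfl

theorem inChart_apply_chartField [IsManifold I 1 M] {p : ℕ} (η : DiffForm I M p) {x₀ : M}
    {y : E} (hy : y ∈ (extChartAt I x₀).target) (X : Fin p → (x : M) → TangentSpace I x) :
    (η.inChart x₀ y fun i => chartField (X i) x₀ y) =
      η ((extChartAt I x₀).symm y) fun i => X i ((extChartAt I x₀).symm y) := by
  rw [inChart_apply]
  congr 1
  funext i
  exact chartSymmDeriv_chartField (X i) hy

theorem inChart_apply_chartDeriv [IsManifold I 1 M] {p : ℕ} (η : DiffForm I M p) (x : M)
    (v : Fin p → TangentSpace I x) :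
    (η.inChart x (extChartAt I x x) fun i => chartDeriv I x (v i)) = η x v := by
  have key : ∀ {z : M} (_ : z = x) (w : Fin p → TangentSpace I z),
      (∀ i, (w i : E) = v i) → η z w = η x v := by
    rintro z rfl w hw
    congr 1
    funext i
    exact hw i
  rw [inChart_apply]
  refine key (extChartAt_to_inv x) _ fun i => ?_
  exact congrArg (fun L : E →L[ℝ] E => L (v i))
    (mfderivWithin_extChartAt_symm_comp_mfderiv_extChartAt' (mem_extChartAt_source (I := I) x))

theorem extDeriv_apply {p : ℕ} (η : DiffForm I M p) (x : M) (v : Fin (p + 1) → TangentSpace I x) :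
    η.extDeriv x v = extDerivWithin (η.inChart x) (range I) (extChartAt I x x)
      fun i => chartDeriv I x (v i) :=
  rfl

theorem extDeriv_ofFun [IsManifold I 1 M] {f : M → ℝ} {x : M}
    (hf : DifferentiableWithinAt ℝ (f ∘ (extChartAt I x).symm) (range I) (extChartAt I x x))
    (v : Fin 1 → TangentSpace I x) :
    (ofFun f).extDeriv x v = dirDeriv I f x (v 0) := by
  have h : (ofFun (I := I) f).inChart x = fun y =>
      ContinuousAlternatingMap.constOfIsEmpty ℝ E (Fin 0) ((f ∘ (extChartAt I x).symm) y) := rfl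
  have hu : UniqueDiffWithinAt ℝ (range I) (extChartAt I x x) :=
    I.uniqueDiffOn _ (mem_range_self _)
  rw [extDeriv_apply, h, extDerivWithin_constOfIsEmpty _ hu, dirDeriv_of_differentiableWithinAt hf]
  rfl

theorem apply_vectorField_eventuallyEq [IsManifold I 1 M] (α : DiffForm I M 1) (x : M)
    (X : (x : M) → TangentSpace I x) :
    (fun y => α.inChart x y fun _ => chartField X x y) =ᶠ[𝓝[range I] (extChartAt I x x)]
      (fun y => α y ![X y]) ∘ (extChartAt I x).symm := by
  filter_upwards [extChartAt_target_mem_nhdsWithin x] with y hy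
  refine (α.inChart_apply_chartField hy fun _ => X).trans ?_
  change α _ _ = α _ _
  congr 1
  funext i
  fin_cases i
  rfl

/-- A `1`-form evaluated on a vector field is differentiable in charts. -/
theorem differentiableWithinAt_apply_vectorField [CompleteSpace E] [IsManifold I 2 M]
    {α : DiffForm I M 1} {x : M}
    (hα : DifferentiableWithinAt ℝ (α.inChart x) (range I) (extChartAt I x x))
    {X : (x : M) → TangentSpace I x}
    (hX : MDifferentiableAt I I.tangent (fun y => (⟨y, X y⟩ : TangentBundle I M)) x) :
    DifferentiableWithinAt ℝ ((fun y => α y ![X y]) ∘ (extChartAt I x).symm) (range I)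
      (extChartAt I x x) := by
  have : IsManifold I 1 M := .of_le (n := 2) (by norm_num)
  have heq := α.apply_vectorField_eventuallyEq x X
  refine DifferentiableWithinAt.congr_of_eventuallyEq ?_ heq.symm
    (heq.eq_of_nhdsWithin (mem_range_self _)).symm
  have h2 : DifferentiableWithinAt ℝ (fun y =>
      (ContinuousAlternatingMap.ofSubsingletonLIE (𝕜 := ℝ) (E := E) (F := ℝ) (0 : Fin 1)).symm
        (α.inChart x y) (chartField X x y)) (range I) (extChartAt I x x) := by
    refine DifferentiableWithinAt.clm_apply ?_ (differentiableWithinAt_chartField hX)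
    exact (LinearIsometryEquiv.differentiableAt _).comp_differentiableWithinAt _ hα
  exact h2

/-- Cartan's formula for the exterior derivative of a `1`-form. -/
theorem extDeriv_apply_vectorField [CompleteSpace E] [IsManifold I 2 M]
    {α : DiffForm I M 1} {x : M}
    (hα : DifferentiableWithinAt ℝ (α.inChart x) (range I) (extChartAt I x x))
    {X Y : (x : M) → TangentSpace I x}
    (hX : MDifferentiableAt I I.tangent (fun y => (⟨y, X y⟩ : TangentBundle I M)) x)
    (hY : MDifferentiableAt I I.tangent (fun y => (⟨y, Y y⟩ : TangentBundle I M)) x) :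
    α.extDeriv x ![X x, Y x] =
      dirDeriv I (fun y => α y ![Y y]) x (X x) - dirDeriv I (fun y => α y ![X y]) x (Y x)
        - α x ![mlieBracket I X Y x] := by
  have : IsManifold I 1 M := .of_le (n := 2) (by norm_num)
  have hu : UniqueDiffWithinAt ℝ (range I) (extChartAt I x x) :=
    I.uniqueDiffOn _ (mem_range_self _)
  have hd : ∀ {Z W : (x : M) → TangentSpace I x},
      MDifferentiableAt I I.tangent (fun y => (⟨y, W y⟩ : TangentBundle I M)) x →
      dirDeriv I (fun y => α y ![W y]) x (Z x) = fderivWithin ℝ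
        (fun y => α.inChart x y fun _ => chartField W x y) (range I) (extChartAt I x x)
        (chartField Z x (extChartAt I x x)) := by
    intro Z W hW
    have heq := α.apply_vectorField_eventuallyEq x W
    rw [dirDeriv_of_differentiableWithinAt (differentiableWithinAt_apply_vectorField hα hW),
      heq.fderivWithin_eq (heq.eq_of_nhdsWithin (mem_range_self _)), chartDeriv_apply]
  have hb : α x ![mlieBracket I X Y x] = α.inChart x (extChartAt I x x)
      fun _ => lieBracketWithin ℝ (chartField X x) (chartField Y x) (range I)
        (extChartAt I x x) := by
    rw [← α.inChart_apply_chartDeriv, ← chartDeriv_mlieBracket]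
    simp
  have hV : ∀ i, DifferentiableWithinAt ℝ ((![chartField X x, chartField Y x] : Fin 2 → E → E) i)
      (range I) (extChartAt I x x) := by
    intro i
    fin_cases i
    exacts [differentiableWithinAt_chartField hX, differentiableWithinAt_chartField hY]
  have key := extDerivWithin_apply_vectorField hα hV hu
  have hl : (fun i => chartDeriv I x ((![X x, Y x] : Fin 2 → TangentSpace I x) i)) =
      fun i => (![chartField X x, chartField Y x] : Fin 2 → E → E) i (extChartAt I x x) := by
    funext i
    fin_cases i
    exacts [chartDeriv_apply X x, chartDeriv_apply Y x]
  rw [hd hX, hd hY, hb, extDeriv_apply, hl, key]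
  have h₁ : ∀ a b : E,
      (Fin.removeNth 1 fun i => Matrix.vecCons a (fun _ : Fin 1 => b) i) = fun _ => a := by
    intro a b
    funext i
    fin_cases i
    rfl
  have h₂ : ∀ (a : E) (t : Fin 0 → E), Matrix.vecCons a t = fun _ => a := by
    intro a t
    funext i
    fin_cases i
    rfl
  simp [Fin.sum_univ_succ, h₁, h₂, sub_eq_add_neg]
end DiffForm

end ChartCalculus

section LieDerivative

variable {E : Type*} [NormedAddCommGroup E] [NormedSpace ℝ E]
  {H : Type*} [TopologicalSpace H] {I : ModelWithCorners ℝ E H}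
  {M : Type*} [TopologicalSpace M] [ChartedSpace H M]

theorem DifferentiableWithinAt.of_forall_clm_apply {D F G : Type*} [NormedAddCommGroup D]
    [NormedSpace ℝ D] [NormedAddCommGroup F] [NormedSpace ℝ F] [NormedAddCommGroup G]
    [NormedSpace ℝ G] [FiniteDimensional ℝ F] {f : D → F →L[ℝ] G} {s : Set D} {x : D}
    (h : ∀ v, DifferentiableWithinAt ℝ (fun y => f y v) s x) : DifferentiableWithinAt ℝ f s x := by
  let d := Module.finrank ℝ F
  have hd : d = Module.finrank ℝ (Fin d → ℝ) := (Module.finrank_fin_fun ℝ).symm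
  let e₁ := ContinuousLinearEquiv.ofFinrankEq hd
  let e₂ := (e₁.arrowCongr (1 : G ≃L[ℝ] G)).trans (ContinuousLinearEquiv.piRing (Fin d))
  rw [← Function.id_comp f, ← e₂.symm_comp_self]
  exact e₂.symm.differentiable.differentiableAt.comp_differentiableWithinAt x
    (differentiableWithinAt_pi.2 fun i => h _)

namespace DiffForm

theorem insertion_one_apply (K : (x : M) → TangentSpace I x →L[ℝ] TangentSpace I x)
    (α : DiffForm I M 1) (x : M) (v : TangentSpace I x) :
    insertion K α x (fun _ => v) = α x ![K x v] := by
  rw [insertion, insertEndomorphism_apply, Fin.sum_univ_one]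
  congr 1
  funext i
  fin_cases i
  simp

theorem insertion_two_apply (K : (x : M) → TangentSpace I x →L[ℝ] TangentSpace I x)
    (β : DiffForm I M 2) (x : M) (v w : TangentSpace I x) :
    insertion K β x ![v, w] = β x ![K x v, w] + β x ![v, K x w] := by
  rw [insertion, insertEndomorphism_apply, Fin.sum_univ_two]
  congr 2 <;>
  · funext i
    fin_cases i <;> simp

/-- The insertion of a differentiable endomorphism in a differentiable `1`-form is
differentiable. -/
theorem differentiableWithinAt_insertion [FiniteDimensional ℝ E] [IsManifold I 2 M]
    {K : (x : M) → TangentSpace I x →L[ℝ] TangentSpace I x} {α : DiffForm I M 1} {x : M}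
    (hα : DifferentiableWithinAt ℝ (α.inChart x) (range I) (extChartAt I x x))
    (hK : MDifferentiableAt I (I.prod 𝓘(ℝ, E →L[ℝ] E)) (fun y =>
      Bundle.TotalSpace.mk' (E →L[ℝ] E) (E := fun y : M => TangentSpace I y →L[ℝ] TangentSpace I y)
        y (K y)) x) :
    DifferentiableWithinAt ℝ ((insertion K α).inChart x) (range I) (extChartAt I x x) := by
  have : IsManifold I 1 M := .of_le (n := 2) (by norm_num)
  have : CompleteSpace E := FiniteDimensional.complete ℝ E
  let e := ContinuousAlternatingMap.ofSubsingletonLIE (𝕜 := ℝ) (E := E) (F := ℝ) (0 : Fin 1)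
  suffices h : DifferentiableWithinAt ℝ (fun y => e.symm ((insertion K α).inChart x y)) (range I)
      (extChartAt I x x) by
    have := e.differentiableAt.comp_differentiableWithinAt _ h
    refine this.congr (fun y _ => ?_) ?_ <;> exact (e.apply_symm_apply _).symm
  refine .of_forall_clm_apply fun v => ?_
  let W : (y : M) → TangentSpace I y := mpullback I 𝓘(ℝ, E) (extChartAt I x) fun _ => v
  have hW : MDifferentiableAt I I.tangent (fun y => (⟨y, W y⟩ : TangentBundle I M)) x := by
    refine MDifferentiableAt.mpullback_vectorField (n := 2) ?_
      (contMDiffAt_extChartAt' (mem_chart_source H x))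
      (isInvertible_mfderiv_extChartAt (mem_extChartAt_source x)) le_rfl
    exact (contMDiffAt_vectorSpace_iff_contDiffAt.2
      (contDiffAt_const (n := 1) (c := v))).mdifferentiableAt one_ne_zero
  have hZ : MDifferentiableAt I I.tangent
      (fun y => (⟨y, K y (W y)⟩ : TangentBundle I M)) x := hK.clm_bundle_apply hW
  have heq : (fun y => e.symm ((insertion K α).inChart x y) v) =ᶠ[𝓝[range I] (extChartAt I x x)]
      (fun y => α y ![K y (W y)]) ∘ (extChartAt I x).symm := by
    filter_upwards [extChartAt_target_mem_nhdsWithin x] with y hy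
    have hy' : chartSymmDeriv I x y v = W ((extChartAt I x).symm y) := by
      have h1 := congrArg (fun L : E →L[ℝ] E => L v)
        (mfderiv_extChartAt_comp_mfderivWithin_extChartAt_symm hy)
      have h2 := (isInvertible_mfderiv_extChartAt ((extChartAt I x).map_target hy))
      refine h2.injective (Eq.trans h1 ?_)
      exact (h2.self_apply_inverse _).symm
    change (insertion K α).inChart x y (fun _ => v) = α _ _
    rw [inChart_apply, insertion_one_apply, hy']
  exact (differentiableWithinAt_apply_vectorField hα hZ).congr_of_eventuallyEq heq
    (heq.eq_of_nhdsWithin (mem_range_self _))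

/-- The Lie derivative of a function: `𝓛_K f = df ∘ K`. -/
theorem lieDeriv_ofFun [IsManifold I 1 M]
    (K : (x : M) → TangentSpace I x →L[ℝ] TangentSpace I x) {f : M → ℝ} {x : M}
    (hf : DifferentiableWithinAt ℝ (f ∘ (extChartAt I x).symm) (range I) (extChartAt I x x))
    (v : TangentSpace I x) :
    lieDeriv K 0 (ofFun f) x ![v] = dirDeriv I f x (K x v) := by
  have h0 : insertion K (ofFun (I := I) f) = ofFun fun _ => 0 := by
    funext y
    ext w
    rw [insertion, insertEndomorphism_apply]
    simp [ofFun]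
  have h1 : (ofFun (I := I) fun _ : M => (0 : ℝ)).extDeriv x ![v] = 0 := by
    rw [extDeriv_ofFun (differentiableWithinAt_const _)]
    simp [dirDeriv, mfderiv_const]
    rfl
  have h2 : insertion K (ofFun (I := I) f).extDeriv x ![v] = dirDeriv I f x (K x v) := by
    have := insertion_one_apply K (ofFun (I := I) f).extDeriv x v
    rw [extDeriv_ofFun hf] at this
    simpa only [Matrix.vec_single_eq_const] using! this
  rw [lieDeriv, h0]
  change insertion K (ofFun (I := I) f).extDeriv x ![v] - (ofFun fun _ => 0).extDeriv x ![v] = _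
  rw [h1, h2, sub_zero]

/-- The bracket determined by `𝓛_K` is the contracted bracket. -/
theorem apply_contractedBracket [FiniteDimensional ℝ E] [IsManifold I 2 M]
    {K : (x : M) → TangentSpace I x →L[ℝ] TangentSpace I x} {α : DiffForm I M 1} {x : M}
    (hα : DifferentiableWithinAt ℝ (α.inChart x) (range I) (extChartAt I x x))
    (hK : MDifferentiableAt I (I.prod 𝓘(ℝ, E →L[ℝ] E)) (fun y =>
      Bundle.TotalSpace.mk' (E →L[ℝ] E) (E := fun y : M => TangentSpace I y →L[ℝ] TangentSpace I y)
        y (K y)) x)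
    {X Y : (x : M) → TangentSpace I x}
    (hX : MDifferentiableAt I I.tangent (fun y => (⟨y, X y⟩ : TangentBundle I M)) x)
    (hY : MDifferentiableAt I I.tangent (fun y => (⟨y, Y y⟩ : TangentBundle I M)) x) :
    α x ![contractedBracket I K X Y x] =
      lieDeriv K 0 (ofFun fun y => α y ![Y y]) x ![X x]
      - lieDeriv K 0 (ofFun fun y => α y ![X y]) x ![Y x] - lieDeriv K 1 α x ![X x, Y x] := by
  have : IsManifold I 1 M := .of_le (n := 2) (by norm_num)
  have : CompleteSpace E := FiniteDimensional.complete ℝ E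
  have hKX : MDifferentiableAt I I.tangent
      (fun y => (⟨y, K y (X y)⟩ : TangentBundle I M)) x := hK.clm_bundle_apply hX
  have hKY : MDifferentiableAt I I.tangent
      (fun y => (⟨y, K y (Y y)⟩ : TangentBundle I M)) x := hK.clm_bundle_apply hY
  have hα' := differentiableWithinAt_insertion hα hK
  have hi : ∀ Z : (x : M) → TangentSpace I x, ∀ y, insertion K α y ![Z y] = α y ![K y (Z y)] :=
    fun Z y => by
      simpa only [Matrix.vec_single_eq_const] using! insertion_one_apply K α y (Z y)
  have hd : lieDeriv K 1 α x ![X x, Y x] = insertion K α.extDeriv x ![X x, Y x]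
      - (insertion K α).extDeriv x ![X x, Y x] := rfl
  have e1 := extDeriv_apply_vectorField hα hKX hY
  have e2 := extDeriv_apply_vectorField hα hX hKY
  have e3 := extDeriv_apply_vectorField hα' hX hY
  simp only [hi] at e3
  have ha : ∀ u v w : TangentSpace I x,
      α x ![u + v - w] = α x ![u] + α x ![v] - α x ![w] := by
    intro u v w
    have h : ∀ z : TangentSpace I x, α x ![z] =
        (ContinuousAlternatingMap.ofSubsingleton ℝ (TangentSpace I x) ℝ (0 : Fin 1)).symm (α x) z :=
      fun z => by
        rw [Matrix.vec_single_eq_const]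
        rfl
    simp only [h, map_add, map_sub]
  rw [lieDeriv_ofFun K (differentiableWithinAt_apply_vectorField hα hX),
    lieDeriv_ofFun K (differentiableWithinAt_apply_vectorField hα hY), hd, insertion_two_apply,
    e1, e2, e3, contractedBracket, ha]
  ring

end DiffForm

end LieDerivative

section Algebroid

variable {E : Type*} [NormedAddCommGroup E] [NormedSpace ℝ E]
  {H : Type*} [TopologicalSpace H] {I : ModelWithCorners ℝ E H}
  {M : Type*} [TopologicalSpace M] [ChartedSpace H M]

namespace DiffForm

variable (I) in
/-- The differential of a function, as a `1`-form. -/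
def differential (f : M → ℝ) : DiffForm I M 1 := fun x =>
  ContinuousAlternatingMap.ofSubsingleton ℝ (TangentSpace I x) ℝ (0 : Fin 1)
    (mfderiv I 𝓘(ℝ, ℝ) f x : TangentSpace I x →L[ℝ] ℝ)

theorem differential_apply (f : M → ℝ) (x : M) (v : TangentSpace I x) :
    differential I f x ![v] = dirDeriv I f x v := rfl

theorem isSmooth_differential [IsManifold I ∞ M] {f : M → ℝ} (hf : ContMDiff I 𝓘(ℝ, ℝ) ∞ f) :
    (differential I f).IsSmooth := by
  intro x₀
  have : IsManifold I 1 M := .of_le (n := ∞) (by simp)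
  have hu : UniqueDiffOn ℝ (extChartAt I x₀).target := uniqueDiffOn_extChartAt_target x₀
  have hc : ContDiffOn ℝ ∞ (f ∘ (extChartAt I x₀).symm) (extChartAt I x₀).target :=
    (hf.comp_contMDiffOn (contMDiffOn_extChartAt_symm x₀)).contDiffOn
  let e := ContinuousAlternatingMap.ofSubsingletonLIE (𝕜 := ℝ) (E := E) (F := ℝ) (0 : Fin 1)
  refine (e.contDiff.comp_contDiffOn (hc.fderivWithin hu (m := ∞) (by simp))).congr ?_
  intro y hy
  have hs : MDifferentiableWithinAt 𝓘(ℝ, E) I (extChartAt I x₀).symm (range I) y :=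
    mdifferentiableWithinAt_extChartAt_symm hy
  have h1 := mfderiv_comp_mfderivWithin (I'' := 𝓘(ℝ, ℝ)) y
    ((hf.mdifferentiable (by simp)) ((extChartAt I x₀).symm y)) hs
    (I.uniqueDiffOn.uniqueMDiffOn _ (extChartAt_target_subset_range x₀ hy))
  rw [mfderivWithin_eq_fderivWithin] at h1
  have h2 : fderivWithin ℝ (f ∘ (extChartAt I x₀).symm) (extChartAt I x₀).target y =
      fderivWithin ℝ (f ∘ (extChartAt I x₀).symm) (range I) y :=
    fderivWithin_congr_set (extChartAt_target_eventuallyEq_of_mem hy)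
  change _ = e (fderivWithin ℝ (f ∘ (extChartAt I x₀).symm) (extChartAt I x₀).target y)
  rw [h2, h1]
  rfl

theorem IsSmooth.differentiableWithinAt {p : ℕ} {η : DiffForm I M p} (hη : η.IsSmooth) (x : M) :
    DifferentiableWithinAt ℝ (η.inChart x) (range I) (extChartAt I x x) :=
  (((hη x).differentiableOn (by simp)) _ (mem_extChartAt_target x)).mono_of_mem_nhdsWithin
    (extChartAt_target_mem_nhdsWithin x)

end DiffForm

/-- The contracted bracket of an algebra with bracket `b` and an endomorphism `K` with vanishing
Nijenhuis torsion satisfies the Jacobi identity. -/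
theorem jacobi_contracted {L : Type*} [AddCommGroup L] (b c : L → L → L) (K : L → L)
    (b_add : ∀ X Y Z, b X (Y + Z) = b X Y + b X Z) (b_neg : ∀ X Y, b X (-Y) = - b X Y)
    (b_skew : ∀ X Y, b X Y = - b Y X)
    (b_jacobi : ∀ X Y Z, b X (b Y Z) = b (b X Y) Z + b Y (b X Z))
    (K_add : ∀ X Y, K (X + Y) = K X + K Y) (K_neg : ∀ X, K (-X) = - K X)
    (hc : ∀ X Y, c X Y = b (K X) Y + b X (K Y) - K (b X Y))
    (hK : ∀ X Y, K (c X Y) = b (K X) (K Y)) (X Y Z : L) :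
    c X (c Y Z) + c Y (c Z X) + c Z (c X Y) = 0 := by
  have b_sub : ∀ X Y Z, b X (Y - Z) = b X Y - b X Z := fun X Y Z => by
    rw [sub_eq_add_neg, b_add, b_neg, sub_eq_add_neg]
  have K_sub : ∀ X Y, K (X - Y) = K X - K Y := fun X Y => by
    rw [sub_eq_add_neg, K_add, K_neg, sub_eq_add_neg]
  have hT : ∀ X Y, b (K X) (K Y) = K (b (K X) Y) + K (b X (K Y)) - K (K (b X Y)) := fun X Y => by
    rw [← hK, hc, K_sub, K_add]
  have cyc : ∀ X Y Z, b X (b Y Z) + b Y (b Z X) + b Z (b X Y) = 0 := fun X Y Z => by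
    rw [b_jacobi X Y Z, b_skew (b X Y) Z, b_skew Z X, b_neg]
    abel
  have expand : ∀ X Y Z, c X (c Y Z) = b (K X) (b (K Y) Z) + b (K X) (b Y (K Z))
      + b X (b (K Y) (K Z))
      - K (b (K X) (b Y Z) + b X (b (K Y) Z) + b X (b Y (K Z))) + K (K (b X (b Y Z))) := by
    intro X Y Z
    rw [hc X (c Y Z), hK, hc Y Z]
    simp only [b_add, b_sub, K_add, K_sub, hT X (b Y Z)]
    abel
  have K_zero : K 0 = 0 := by simpa using K_add 0 0
  have h1 := cyc (K X) (K Y) Z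
  have h2 := cyc (K Y) (K Z) X
  have h3 := cyc (K Z) (K X) Y
  have h4 := congrArg K (cyc (K X) Y Z)
  have h5 := congrArg K (cyc X (K Y) Z)
  have h6 := congrArg K (cyc X Y (K Z))
  have h7 := congrArg (fun W => K (K W)) (cyc X Y Z)
  simp only [K_add, K_zero] at h4 h5 h6 h7
  rw [expand, expand, expand]
  simp only [K_add]
  linear_combination (norm := abel) h1 + h2 + h3 - h4 - h5 - h6 + h7

end Algebroid

section Sections

variable {E : Type*} [NormedAddCommGroup E] [NormedSpace ℝ E]
  {H : Type*} [TopologicalSpace H] {I : ModelWithCorners ℝ E H}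
  {M : Type*} [TopologicalSpace M] [ChartedSpace H M]

section Bundle

variable {F : Type*} [NormedAddCommGroup F] [NormedSpace ℝ F]
  {V : M → Type*} [TopologicalSpace (Bundle.TotalSpace F V)]
  [∀ x, AddCommGroup (V x)] [∀ x, Module ℝ (V x)] [∀ x, TopologicalSpace (V x)]
  [FiberBundle F V] [VectorBundle ℝ F V]

/-- If a bracket of sections satisfies the Jacobi identity and a Leibniz rule with respect to an
action `ρ` on functions, then `ρ` maps the bracket to the commutator, up to the annihilator of the
sections. -/
theorem smulSection_commutator_eq {b : Cₛ^∞⟮I; F, V⟯ → Cₛ^∞⟮I; F, V⟯ → Cₛ^∞⟮I; F, V⟯}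
    {ρ : Cₛ^∞⟮I; F, V⟯ → C^∞⟮I, M; 𝓘(ℝ, ℝ), ℝ⟯ → C^∞⟮I, M; 𝓘(ℝ, ℝ), ℝ⟯}
    (b_add : ∀ X Y Z, b X (Y + Z) = b X Y + b X Z)
    (b_jacobi : ∀ X Y Z, b X (b Y Z) = b (b X Y) Z + b Y (b X Z))
    (b_smul : ∀ X f Z, b X (smulSection f Z) = smulSection f (b X Z) + smulSection (ρ X f) Z)
    (X Y Z : Cₛ^∞⟮I; F, V⟯) (f : C^∞⟮I, M; 𝓘(ℝ, ℝ), ℝ⟯) :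
    smulSection (ρ (b X Y) f) Z =
      smulSection (ρ X (ρ Y f)) Z - smulSection (ρ Y (ρ X f)) Z := by
  have hZ : smulSection f (b X (b Y Z)) =
      smulSection f (b (b X Y) Z) + smulSection f (b Y (b X Z)) := by
    rw [b_jacobi]
    ext x
    exact smul_add _ _ _
  have h := b_jacobi X Y (smulSection f Z)
  simp only [b_smul, b_add, hZ] at h
  rw [eq_sub_iff_add_eq, ← sub_eq_zero]
  rw [← sub_eq_zero] at h
  rw [← neg_eq_zero, ← h]
  abel

end Bundle

variable [IsManifold I ∞ M]

/-- The derivative of a smooth function along a smooth vector field. -/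
def dirDerivMap (f : C^∞⟮I, M; 𝓘(ℝ, ℝ), ℝ⟯) (X : Cₛ^∞⟮I; E, fun x : M => TangentSpace I x⟯) :
    C^∞⟮I, M; 𝓘(ℝ, ℝ), ℝ⟯ :=
  ⟨fun x => dirDeriv I f x (X x), by
    have h : ContMDiff I (𝓘(ℝ, ℝ).tangent) ∞ fun x =>
        tangentMap I 𝓘(ℝ, ℝ) f (⟨x, X x⟩ : TangentBundle I M) :=
      (f.contMDiff.contMDiff_tangentMap (m := ∞) (by simp)).comp X.contMDiff
    exact (contMDiff_snd_tangentBundle_modelSpace ℝ 𝓘(ℝ, ℝ)).comp h⟩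

variable (K : Cₛ^∞⟮I; E →L[ℝ] E, fun x : M => TangentSpace I x →L[ℝ] TangentSpace I x⟯)

/-- The image of a smooth vector field under a smooth endomorphism of `TM`. -/
def applySection (X : Cₛ^∞⟮I; E, fun x : M => TangentSpace I x⟯) :
    Cₛ^∞⟮I; E, fun x : M => TangentSpace I x⟯ :=
  ⟨fun x => K x (X x), K.contMDiff.clm_bundle_apply X.contMDiff⟩

variable [CompleteSpace E]

/-- The Lie bracket of smooth vector fields. -/
def mlieBracketSection (X Y : Cₛ^∞⟮I; E, fun x : M => TangentSpace I x⟯) :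
    Cₛ^∞⟮I; E, fun x : M => TangentSpace I x⟯ :=
  ⟨mlieBracket I X Y, by
    have : IsManifold I (((⊤ : ℕ∞) : ℕ∞ω) + 1) M := .of_le (n := ∞) (by simp)
    have : IsManifold I (minSmoothness ℝ 2) M := .of_le (n := ∞) (by simpa using ENat.LEInfty.out)
    exact ContDiff.mlieBracket_vectorField (m := (⊤ : ℕ∞)) (n := (⊤ : ℕ∞)) X.contMDiff Y.contMDiff
      (by simp)⟩

/-- The contracted bracket of smooth vector fields. -/
def contractedBracketSection
    (X Y : Cₛ^∞⟮I; E, fun x : M => TangentSpace I x⟯) :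
    Cₛ^∞⟮I; E, fun x : M => TangentSpace I x⟯ :=
  mlieBracketSection (applySection K X) Y + mlieBracketSection X (applySection K Y)
    - applySection K (mlieBracketSection X Y)

end Sections

section Nijenhuis

variable {E : Type*} [NormedAddCommGroup E] [NormedSpace ℝ E]
  {H : Type*} [TopologicalSpace H] {I : ModelWithCorners ℝ E H}
  {M : Type*} [TopologicalSpace M] [ChartedSpace H M]

theorem ContMDiffSection.mdifferentiableAt_infty {F : Type*} [NormedAddCommGroup F]
    [NormedSpace ℝ F] {V : M → Type*} [TopologicalSpace (Bundle.TotalSpace F V)]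
    [∀ x, TopologicalSpace (V x)] [FiberBundle F V] (X : Cₛ^∞⟮I; F, V⟯) (x : M) :
    MDifferentiableAt I (I.prod 𝓘(ℝ, F)) (fun y => Bundle.TotalSpace.mk' F y (X y)) x :=
  (X.contMDiff x).mdifferentiableAt (by simp)

theorem nijenhuisTorsion_eq (K : (x : M) → TangentSpace I x →L[ℝ] TangentSpace I x)
    (X Y : (x : M) → TangentSpace I x) (x : M) :
    nijenhuisTorsion I K X Y x = mlieBracket I (fun y => K y (X y)) (fun y => K y (Y y)) x
      - K x (contractedBracket I K X Y x) := by
  simp only [nijenhuisTorsion, contractedBracket, map_add, map_sub]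
  abel

theorem dirDeriv_sub (f : M → ℝ) (x : M) (v w : TangentSpace I x) :
    dirDeriv I f x (v - w) = dirDeriv I f x v - dirDeriv I f x w :=
  map_sub (mfderiv I 𝓘(ℝ, ℝ) f x) v w

variable [IsManifold I ∞ M]

section Bracket

variable (K : Cₛ^∞⟮I; E →L[ℝ] E, fun x : M => TangentSpace I x →L[ℝ] TangentSpace I x⟯)

theorem applySection_add (X Y : Cₛ^∞⟮I; E, fun x : M => TangentSpace I x⟯) :
    applySection K (X + Y) = applySection K X + applySection K Y := by
  ext x
  exact map_add (K x) _ _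

theorem applySection_const_smul (c : ℝ) (X : Cₛ^∞⟮I; E, fun x : M => TangentSpace I x⟯) :
    applySection K (c • X) = c • applySection K X := by
  ext x
  exact map_smul (K x) _ _

theorem applySection_smulSection (f : C^∞⟮I, M; 𝓘(ℝ, ℝ), ℝ⟯)
    (X : Cₛ^∞⟮I; E, fun x : M => TangentSpace I x⟯) :
    applySection K (smulSection f X) = smulSection f (applySection K X) := by
  ext x
  exact map_smul (K x) _ _

variable [CompleteSpace E]

theorem mlieBracketSection_add_right (X Y Z : Cₛ^∞⟮I; E, fun x : M => TangentSpace I x⟯) :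
    mlieBracketSection X (Y + Z) = mlieBracketSection X Y + mlieBracketSection X Z := by
  have : IsManifold I 2 M := .of_le (n := ∞) ENat.LEInfty.out
  ext x
  exact mlieBracket_add_right (Y.mdifferentiableAt_infty x) (Z.mdifferentiableAt_infty x)

theorem mlieBracketSection_const_smul_right (c : ℝ)
    (X Y : Cₛ^∞⟮I; E, fun x : M => TangentSpace I x⟯) :
    mlieBracketSection X (c • Y) = c • mlieBracketSection X Y := by
  have : IsManifold I 2 M := .of_le (n := ∞) ENat.LEInfty.out
  ext x
  exact mlieBracket_const_smul_right (Y.mdifferentiableAt_infty x)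

theorem mlieBracketSection_skew (X Y : Cₛ^∞⟮I; E, fun x : M => TangentSpace I x⟯) :
    mlieBracketSection X Y = - mlieBracketSection Y X := by
  ext x
  exact mlieBracket_swap_apply

theorem mlieBracketSection_jacobi (X Y Z : Cₛ^∞⟮I; E, fun x : M => TangentSpace I x⟯) :
    mlieBracketSection X (mlieBracketSection Y Z) =
      mlieBracketSection (mlieBracketSection X Y) Z
        + mlieBracketSection Y (mlieBracketSection X Z) := by
  have : IsManifold I (minSmoothness ℝ 3) M := .of_le (n := ∞) (by simpa using ENat.LEInfty.out)
  have h2 : minSmoothness ℝ 2 ≤ ∞ := by simpa using ENat.LEInfty.out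
  ext x
  exact leibniz_identity_mlieBracket_apply ((X.contMDiff x).of_le h2) ((Y.contMDiff x).of_le h2)
    ((Z.contMDiff x).of_le h2)

theorem mlieBracketSection_smulSection_right (X : Cₛ^∞⟮I; E, fun x : M => TangentSpace I x⟯)
    (f : C^∞⟮I, M; 𝓘(ℝ, ℝ), ℝ⟯) (Y : Cₛ^∞⟮I; E, fun x : M => TangentSpace I x⟯) :
    mlieBracketSection X (smulSection f Y) =
      smulSection f (mlieBracketSection X Y) + smulSection (dirDerivMap f X) Y := by
  have : IsManifold I 2 M := .of_le (n := ∞) ENat.LEInfty.out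
  ext x
  exact (mlieBracket_smul_right f.mdifferentiableAt (Y.mdifferentiableAt_infty x)).trans
    (add_comm _ _)

theorem contractedBracketSection_add_right (X Y Z : Cₛ^∞⟮I; E, fun x : M => TangentSpace I x⟯) :
    contractedBracketSection K X (Y + Z) =
      contractedBracketSection K X Y + contractedBracketSection K X Z := by
  simp only [contractedBracketSection, applySection_add, mlieBracketSection_add_right]
  abel

theorem contractedBracketSection_const_smul_right (c : ℝ)
    (X Y : Cₛ^∞⟮I; E, fun x : M => TangentSpace I x⟯) :
    contractedBracketSection K X (c • Y) = c • contractedBracketSection K X Y := by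
  simp only [contractedBracketSection, applySection_const_smul,
    mlieBracketSection_const_smul_right, smul_sub, smul_add]

theorem contractedBracketSection_skew (X Y : Cₛ^∞⟮I; E, fun x : M => TangentSpace I x⟯) :
    contractedBracketSection K X Y = - contractedBracketSection K Y X := by
  have h : applySection K (-mlieBracketSection Y X) = -applySection K (mlieBracketSection Y X) := by
    simpa using applySection_const_smul K (-1) (mlieBracketSection Y X)
  simp only [contractedBracketSection]
  rw [mlieBracketSection_skew (applySection K X), mlieBracketSection_skew X,
    mlieBracketSection_skew X, h]
  abel

theorem contractedBracketSection_smulSection_right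
    (X : Cₛ^∞⟮I; E, fun x : M => TangentSpace I x⟯) (f : C^∞⟮I, M; 𝓘(ℝ, ℝ), ℝ⟯)
    (Y : Cₛ^∞⟮I; E, fun x : M => TangentSpace I x⟯) :
    contractedBracketSection K X (smulSection f Y) = smulSection f (contractedBracketSection K X Y)
      + smulSection (dirDerivMap f (applySection K X)) Y := by
  have h : smulSection f (contractedBracketSection K X Y) =
      smulSection f (mlieBracketSection (applySection K X) Y)
        + smulSection f (mlieBracketSection X (applySection K Y))
        - smulSection f (applySection K (mlieBracketSection X Y)) := by
    ext x
    simp [contractedBracketSection, smulSection, smul_add, smul_sub]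
  rw [h]
  simp only [contractedBracketSection, applySection_smulSection, applySection_add,
    mlieBracketSection_smulSection_right]
  abel

/-- The Lie algebroid structure on `TM` defined by an endomorphism with vanishing Nijenhuis
torsion. -/
def LieAlgebroid.ofNijenhuis
    (hK : ∀ X Y : Cₛ^∞⟮I; E, fun x : M => TangentSpace I x⟯, nijenhuisTorsion I K X Y = 0) :
    LieAlgebroid I E (fun x : M => TangentSpace I x) where
  anchor := K
  bracket := LinearMap.mk₂ ℝ (contractedBracketSection K)
    (fun X Y Z => by
      rw [contractedBracketSection_skew, contractedBracketSection_add_right,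
        contractedBracketSection_skew K Z X, contractedBracketSection_skew K Z Y]
      abel)
    (fun c X Y => by
      rw [contractedBracketSection_skew, contractedBracketSection_const_smul_right,
        contractedBracketSection_skew K Y X, smul_neg, neg_neg])
    (contractedBracketSection_add_right K) (contractedBracketSection_const_smul_right K)
  bracket_self X := by
    ext x
    have h := congrArg (fun S : Cₛ^∞⟮I; E, fun x : M => TangentSpace I x⟯ => S x)
      (contractedBracketSection_skew K X X)
    have : IsAddTorsionFree E := .of_isTorsionFree ℝ E
    exact (self_eq_neg (G := E)).1 h
  jacobi := by
    refine jacobi_contracted mlieBracketSection (contractedBracketSection K) (applySection K)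
      mlieBracketSection_add_right (fun X Y => ?_) mlieBracketSection_skew
      mlieBracketSection_jacobi (applySection_add K) (fun X => ?_) (fun _ _ => rfl)
      (fun X Y => ?_)
    · simpa using mlieBracketSection_const_smul_right (-1) X Y
    · simpa using applySection_const_smul K (-1) X
    · ext x
      have h := congrFun (hK X Y) x
      rw [nijenhuisTorsion_eq] at h
      exact (sub_eq_zero.1 h).symm
  leibniz f X Y x :=
    congrArg (fun S : Cₛ^∞⟮I; E, fun x : M => TangentSpace I x⟯ => S x)
      (contractedBracketSection_smulSection_right K X f Y)

end Bracket

/-- A Lie algebroid structure on `TM` with anchor `K` and bracket the contracted bracket forces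
the Nijenhuis torsion of `K` to vanish. -/
theorem LieAlgebroid.nijenhuisTorsion_eq_zero [FiniteDimensional ℝ E] [T2Space M]
    (A : LieAlgebroid I E (fun x : M => TangentSpace I x))
    (hA : ∀ X Y, ⇑(A.bracket X Y) = contractedBracket I A.anchor X Y)
    (X Y : Cₛ^∞⟮I; E, fun x : M => TangentSpace I x⟯) :
    nijenhuisTorsion I A.anchor X Y = 0 := by
  have : CompleteSpace E := FiniteDimensional.complete ℝ E
  funext x
  by_contra hne
  obtain ⟨f, hf⟩ := exists_dirDeriv_ne_zero (I := I) hne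
  obtain ⟨Z, hZ⟩ := exists_contMDiffSection_apply_eq (I := I) (F := E)
    (V := fun x : M => TangentSpace I x) (nijenhuisTorsion I A.anchor X Y x)
  have skew : ∀ W T, A.bracket W T = - A.bracket T W := by
    intro W T
    have h := A.bracket_self (W + T)
    simp only [map_add, LinearMap.add_apply, A.bracket_self, zero_add, add_zero] at h
    exact eq_neg_of_add_eq_zero_right h
  have h1 := smulSection_commutator_eq mlieBracketSection_add_right mlieBracketSection_jacobi
    mlieBracketSection_smulSection_right (applySection A.anchor X) (applySection A.anchor Y) Z f
  have h2 := smulSection_commutator_eq (b := fun W T => A.bracket W T)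
    (ρ := fun W g => dirDerivMap g (applySection A.anchor W)) (fun W => map_add (A.bracket W))
    (fun U V W => by
      have h := A.jacobi U V W
      rw [skew W U, skew W (A.bracket U V), map_neg] at h
      rw [← sub_eq_zero, ← h]
      abel)
    (fun W g T => by
      ext y
      exact A.leibniz g W T y) X Y Z f
  have h3 : dirDeriv I f x (mlieBracket I (applySection A.anchor X) (applySection A.anchor Y) x)
      • Z x = dirDeriv I f x (A.anchor x (A.bracket X Y x)) • Z x :=
    congrArg (fun S : Cₛ^∞⟮I; E, fun x : M => TangentSpace I x⟯ => S x) (h1.trans h2.symm)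
  rw [← sub_eq_zero, ← sub_smul, ← dirDeriv_sub, hA X Y, hZ] at h3
  have h4 := nijenhuisTorsion_eq A.anchor X Y x
  refine (smul_eq_zero.1 h3).elim (fun h => hf ?_) hne
  rw [h4]
  exact h

section Induced

variable [FiniteDimensional ℝ E]
  (K : Cₛ^∞⟮I; E →L[ℝ] E, fun x : M => TangentSpace I x →L[ℝ] TangentSpace I x⟯)

theorem LieAlgebroid.isInducedBy_of_eq (A : LieAlgebroid I E (fun x : M => TangentSpace I x))
    (hanchor : A.anchor = K) (hbracket : ∀ X Y, ⇑(A.bracket X Y) = contractedBracket I K X Y) :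
    A.IsInducedBy (DiffForm.lieDeriv K) where
  anchor_eq f X x := by
    have : IsManifold I 1 M := .of_le (n := ∞) (by simp)
    rw [DiffForm.lieDeriv_ofFun _
      (differentiableWithinAt_comp_extChartAt_symm f.mdifferentiableAt), hanchor]
  bracket_eq α hα X Y x := by
    have : IsManifold I 2 M := .of_le (n := ∞) ENat.LEInfty.out
    rw [hbracket]
    exact DiffForm.apply_contractedBracket (hα.differentiableWithinAt x)
      (K.mdifferentiableAt_infty x) (X.mdifferentiableAt_infty x) (Y.mdifferentiableAt_infty x)

theorem LieAlgebroid.IsInducedBy.anchor_eq_and_bracket_eq [T2Space M]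
    {A : LieAlgebroid I E (fun x : M => TangentSpace I x)}
    (hA : A.IsInducedBy (DiffForm.lieDeriv K)) :
    A.anchor = K ∧ ∀ X Y, ⇑(A.bracket X Y) = contractedBracket I K X Y := by
  have : IsManifold I 1 M := .of_le (n := ∞) (by simp)
  have : IsManifold I 2 M := .of_le (n := ∞) ENat.LEInfty.out
  constructor
  · ext1 x
    refine ContinuousLinearMap.ext fun v => eq_of_forall_dirDeriv_eq fun f => ?_
    obtain ⟨X, rfl⟩ := exists_contMDiffSection_apply_eq (I := I) (F := E)
      (V := fun x : M => TangentSpace I x) v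
    rw [hA.anchor_eq, DiffForm.lieDeriv_ofFun _
      (differentiableWithinAt_comp_extChartAt_symm f.mdifferentiableAt)]
  · intro X Y
    funext x
    refine eq_of_forall_dirDeriv_eq fun f => ?_
    have hα := DiffForm.isSmooth_differential (I := I) f.contMDiff
    rw [← DiffForm.differential_apply, ← DiffForm.differential_apply, hA.bracket_eq _ hα,
      DiffForm.apply_contractedBracket (hα.differentiableWithinAt x)
        (K.mdifferentiableAt_infty x) (X.mdifferentiableAt_infty x) (Y.mdifferentiableAt_infty x)]

end Induced

end Nijenhuis

end

theorem mainTheorem8 {E : Type*} [NormedAddCommGroup E] [NormedSpace ℝ E] [FiniteDimensional ℝ E]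
    {H : Type*} [TopologicalSpace H] (I : ModelWithCorners ℝ E H)
    {M : Type*} [TopologicalSpace M] [ChartedSpace H M] [IsManifold I ∞ M]
    [BoundarylessManifold I M] [T2Space M]
    (K : Cₛ^∞⟮I; E →L[ℝ] E, fun x : M => TangentSpace I x →L[ℝ] TangentSpace I x⟯) :
    ((∃ A : LieAlgebroid I E (fun x : M => TangentSpace I x),
        A.IsInducedBy (DiffForm.lieDeriv K) ∧ A.anchor = K ∧
        ∀ X Y, ⇑(A.bracket X Y) = contractedBracket I K X Y) ↔
      ∀ X Y : Cₛ^∞⟮I; E, fun x : M => TangentSpace I x⟯, nijenhuisTorsion I K X Y = 0) ∧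
    ∀ A : LieAlgebroid I E (fun x : M => TangentSpace I x),
      A.IsInducedBy (DiffForm.lieDeriv K) →
        A.anchor = K ∧ ∀ X Y, ⇑(A.bracket X Y) = contractedBracket I K X Y := by
  have : CompleteSpace E := FiniteDimensional.complete ℝ E
  refine ⟨⟨?_, fun hK => ?_⟩, fun A hA => hA.anchor_eq_and_bracket_eq⟩
  · rintro ⟨A, -, rfl, hA⟩ X Y
    exact A.nijenhuisTorsion_eq_zero hA X Y
  · have hb : ∀ X Y, ⇑((LieAlgebroid.ofNijenhuis K hK).bracket X Y) = contractedBracket I K X Y :=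
      fun _ _ => rfl
    exact ⟨.ofNijenhuis K hK, LieAlgebroid.isInducedBy_of_eq K _ rfl hb, rfl, hb⟩
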